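/- Let $M$ be a smooth finite-dimensional Riemannian manifold (without boundary), let $a \le b$, let $X : [a,b] \to M$ be a smooth curve, and let $A$ be a continuously differentiable (for instance, smooth) vector field along $X$, i.e. $A(t) \in T_{X(t)}M$ for all $t \in [a,b]$. Denote by $\nabla A(t) \in T_{X(t)}M$ the Levi-Civita covariant derivative of $A$ along $X$ (one-sided at the endpoints; in local coordinates $(\nabla A)^k = \dot A^k + \sum_{i,j}\Gamma^k_{ij}(X)\,\dot X^i A^j$, with $\Gamma^k_{ij}$ the Christoffel symbols of the metric), and by $\Gamma_{X(t)}^{X(a)} : T_{X(t)}M \to T_{X(a)}M$ the parallel transport along $X$, which sends $v$ to $P(a)$, where $P$ is the vector field along $X$ with $\nabla P = 0$ and $P(t) = v$. Then $t \mapsto \Gamma_{X(t)}^{X(a)} \nabla A(t)$ is an integrable map from $[a,b]$ to the vector space $T_{X(a)}M$, and $$\Gamma_{X(b)}^{X(a)} A(b) - A(a) = \int_a^b \Gamma_{X(t)}^{X(a)} \nabla A(t)\, dt .$$ -/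

import Mathlib

open scoped Manifold ContDiff Bundle

noncomputable section

namespace RiemannianCurve

section Basic

variable {E : Type*} [NormedAddCommGroup E] [NormedSpace ℝ E]
  {M : Type*} [TopologicalSpace M] [ChartedSpace E M]

/-- The coordinate frame: the differential at `y` of the inverse of the chart around `x₀`. Applied
to a basis of `E`, it gives the coordinate vectors `∂₁, …, ∂ₙ` at the point with coordinates `y`. -/
def chartFrame (x₀ : M) (y : E) :
    E →L[ℝ] TangentSpace 𝓘(ℝ, E) ((extChartAt 𝓘(ℝ, E) x₀).symm y) :=
  mfderiv 𝓘(ℝ, E) 𝓘(ℝ, E) (extChartAt 𝓘(ℝ, E) x₀).symm y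

/-- The coordinates, in the chart around `x₀`, of a tangent vector `v` at `p`. -/
def chartCoord (x₀ : M) {p : M} (v : TangentSpace 𝓘(ℝ, E) p) : E :=
  mfderiv 𝓘(ℝ, E) 𝓘(ℝ, E) (extChartAt 𝓘(ℝ, E) x₀) p v

variable [Bundle.RiemannianBundle (fun x : M ↦ TangentSpace 𝓘(ℝ, E) x)]

/-- The metric tensor in the chart around `x₀`:
`chartMetric x₀ y u v` is `g_y(u, v) = ∑ g_{ij}(y) uⁱ vʲ`. -/
def chartMetric (x₀ : M) (y : E) : E →L[ℝ] E →L[ℝ] ℝ :=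
  (innerSL ℝ (E := TangentSpace 𝓘(ℝ, E) ((extChartAt 𝓘(ℝ, E) x₀).symm y))).bilinearComp
    (chartFrame x₀ y) (chartFrame x₀ y)

theorem chartMetric_apply (x₀ : M) (y u v : E) :
    chartMetric x₀ y u v = inner ℝ (chartFrame x₀ y u) (chartFrame x₀ y v) :=
  rfl

/-- The Christoffel symbols of the Levi-Civita connection in the chart around `x₀`:
`christoffel x₀ y u v` is the vector `w = ∑ Γᵏ_{ij}(y) uⁱ vʲ ∂ₖ` that is determined by
`g_y(w, z) = (1/2) (D_u g(v, z) + D_v g(u, z) - D_z g(u, v))` for all `z`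
(at a point of the chart, `g_y` is a nondegenerate bilinear form, so that the inverse exists). -/
def christoffel (x₀ : M) (y u v : E) : E :=
  (chartMetric x₀ y).inverse ((1 / 2 : ℝ) •
    (fderiv ℝ (chartMetric x₀) y u v + fderiv ℝ (chartMetric x₀) y v u
      - ((fderiv ℝ (chartMetric x₀) y).flip u).flip v))

/-- The Levi-Civita covariant derivative `∇A(t)`, along the curve `X : S → M`, of a vector field
`A` along `X`. In the chart around `X t`, where `X` reads `x` and `A` reads `α`, its `k`-th
coordinate is `(αᵏ)' + ∑ Γᵏ_{ij}(x) (xⁱ)' αʲ`. For `S = [a, b]` the derivatives at the endpoints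
are one-sided. -/
def covDerivAlong (S : Set ℝ) (X : ℝ → M) (A : (t : ℝ) → TangentSpace 𝓘(ℝ, E) (X t)) (t : ℝ) :
    TangentSpace 𝓘(ℝ, E) (X t) :=
  let x : ℝ → E := fun s ↦ extChartAt 𝓘(ℝ, E) (X t) (X s)
  let α : ℝ → E := fun s ↦ chartCoord (X t) (A s)
  (mfderiv 𝓘(ℝ, E) 𝓘(ℝ, E) (extChartAt 𝓘(ℝ, E) (X t)) (X t)).inverse
    (derivWithin α S t + christoffel (X t) (x t) (derivWithin x S t) (α t))

variable [IsManifold 𝓘(ℝ, E) 1 M]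

/-- `A` is a vector field of class `C^k` along the curve `X : S → M`. -/
def IsFieldAlong (k : ℕ∞) (S : Set ℝ) (X : ℝ → M)
    (A : (t : ℝ) → TangentSpace 𝓘(ℝ, E) (X t)) : Prop :=
  ContMDiffOn 𝓘(ℝ, ℝ) (𝓘(ℝ, E).prod 𝓘(ℝ, E)) k
    (fun t ↦ (⟨X t, A t⟩ : TangentBundle 𝓘(ℝ, E) M)) S

/-- `P` is a parallel vector field along the curve `X : S → M`. -/
def IsParallelAlong (S : Set ℝ) (X : ℝ → M) (P : (t : ℝ) → TangentSpace 𝓘(ℝ, E) (X t)) : Prop :=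
  IsFieldAlong 1 S X P ∧ ∀ t ∈ S, covDerivAlong S X P t = 0

open Classical in
/-- Parallel transport `Γ_{X(s)}^{X(t)} : T_{X(s)} M → T_{X(t)} M` along the curve `X : S → M`:
the vector `v` is sent to `P t`, where `P` is the parallel vector field along `X` with `P s = v`. -/
def parallelTransport (S : Set ℝ) (X : ℝ → M) (s t : ℝ) (v : TangentSpace 𝓘(ℝ, E) (X s)) :
    TangentSpace 𝓘(ℝ, E) (X t) :=
  if h : ∃ P : (r : ℝ) → TangentSpace 𝓘(ℝ, E) (X r), IsParallelAlong S X P ∧ P s = v then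
    h.choose t
  else 0

end Basic

end RiemannianCurve

end

/-!
Along a curve on `[a, b]` there is a *parallel coframe*: a family of isomorphisms `G t : T_{X(t)}
M → E` that turns `C^1` fields `A` along `X` into `C^1` functions `t ↦ G t (A t)`, and the
covariant derivative into the ordinary one, `(G A)' = G ∇A`. A field is then parallel exactly when
its image under `G` is constant, so that the parallel transport from `X(t)` to `X(a)` is `(G a)⁻¹
∘ G t` (`parallelTransport_eq_of_coframe`), and the claim is `(G a)⁻¹` applied to the fundamental
theorem of calculus for `t ↦ G t (A t)`.

The coframe is built locally and then glued. In one chart, where `X` reads `x`, let `V` be an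
operator-valued solution of the linear equation `V' = V Γ(x, x')`. If `α` are the coordinates of
`A`, then `(V α)' = V (α' + Γ(x, x') α)`, so `V` composed with the differential of the chart is a
parallel coframe near the time at which `V` is the identity (`exists_local_coframe`). On the
overlap of two intervals, two parallel coframes differ by a constant automorphism of `E`
(`coframe_eq_comp`), which makes the gluing possible (`exists_coframe_of_local`).

The covariant derivative at time `t` is defined in the chart around `X t`, a chart that varies
with `t`. To compute it in one fixed chart (`chartCoord_covDerivAlong`) one needs the
transformation law of the Christoffel symbols (`christoffel_transition`), which comes from
differentiating the relation `g = τ^* h` between the expressions of the metric in two charts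
(`koszul_pullback`): the second derivatives of the change of coordinates `τ` enter the Koszul
expression six times, and four of the terms cancel by the symmetry of the second derivative.
-/

namespace RiemannianCurve

open Set Filter Topology

-- The instances on iterated spaces of continuous linear maps are found only at this depth.
set_option maxSynthPendingDepth 3
set_option linter.unusedSectionVars false

/-! ### Linear differential equations and the Koszul expression -/

section Calculus

variable {F : Type*} [NormedAddCommGroup F] [NormedSpace ℝ F]

/-- Local solutions of linear differential equations with continuous coefficients. -/
theorem exists_hasDerivAt_linear_ode [CompleteSpace F] {A : ℝ → F →L[ℝ] F} (hA : Continuous A)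
    (t₀ : ℝ) (x₀ : F) :
    ∃ ε > 0, ∃ α : ℝ → F, α t₀ = x₀ ∧ ContDiffOn ℝ 1 α (Ioo (t₀ - ε) (t₀ + ε)) ∧
      ∀ t ∈ Ioo (t₀ - ε) (t₀ + ε), HasDerivAt α (A t (α t)) t := by
  obtain ⟨K, hK⟩ := (isCompact_Icc (a := t₀ - 1) (b := t₀ + 1)).exists_bound_of_continuousOn
    hA.continuousOn
  have hK0 : 0 ≤ K := (norm_nonneg _).trans (hK t₀ ⟨by linarith, by linarith⟩)
  set L : ℝ := K * (‖x₀‖ + 1) with hL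
  have hL0 : 0 ≤ L := by positivity
  -- `L` bounds the vector field on the unit ball around `x₀` for times within distance `1`, so a
  -- time `ε` with `L * ε ≤ 1` keeps the solution in that ball.
  set ε : ℝ := 1 / (L + 1) with hε
  have hε0 : 0 < ε := by positivity
  have hε1 : ε ≤ 1 := by rw [hε, div_le_one (by positivity)]; linarith
  have hLε : L * ε ≤ 1 := by
    rw [hε, mul_one_div, div_le_one (by positivity)]; linarith
  have hmem : ∀ t ∈ Icc (t₀ - ε) (t₀ + ε), ‖A t‖ ≤ K := fun t ht ↦
    hK t ⟨by linarith [ht.1], by linarith [ht.2]⟩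
  have hPL : IsPicardLindelof (fun t x ↦ A t x)
      (⟨t₀, by constructor <;> linarith⟩ : Icc (t₀ - ε) (t₀ + ε)) x₀ 1 0
      (⟨L, hL0⟩ : NNReal) (⟨K, hK0⟩ : NNReal) := by
    refine ⟨fun t ht ↦ ?_, fun x _ ↦ ?_, fun t ht x hx ↦ ?_, ?_⟩
    · exact ((A t).lipschitz.weaken (hmem t ht)).lipschitzOnWith
    · exact (hA.clm_apply continuous_const).continuousOn
    · refine ((A t).le_opNorm x).trans (mul_le_mul (hmem t ht) ?_ (norm_nonneg _) hK0)
      have : ‖x - x₀‖ ≤ 1 := by simpa [dist_eq_norm] using hx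
      calc ‖x‖ = ‖x₀ + (x - x₀)‖ := by abel_nf
        _ ≤ ‖x₀‖ + 1 := (norm_add_le _ _).trans (by linarith)
    · simpa using! hLε
  obtain ⟨α, hα, hd⟩ := hPL.exists_eq_forall_mem_Icc_hasDerivWithinAt₀
  have hα' : ∀ t ∈ Ioo (t₀ - ε) (t₀ + ε), HasDerivAt α (A t (α t)) t := fun t ht ↦
    (hd t (Ioo_subset_Icc_self ht)).hasDerivAt (Icc_mem_nhds ht.1 ht.2)
  refine ⟨ε, hε0, α, hα, ?_, hα'⟩
  rw [contDiffOn_one_iff_derivWithin isOpen_Ioo.uniqueDiffOn]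
  refine ⟨fun t ht ↦ (hα' t ht).differentiableAt.differentiableWithinAt, ?_⟩
  refine (hA.continuousOn.clm_apply fun t ht ↦
    (hα' t ht).continuousAt.continuousWithinAt).congr fun t ht ↦ ?_
  rw [derivWithin_of_isOpen isOpen_Ioo ht, (hα' t ht).deriv]

/-- The Koszul expression of a bilinear-form-valued map `g`: the linear form
`z ↦ (1/2) (D_u g(v, z) + D_v g(u, z) - D_z g(u, v))`, which is `g(Γ(u, v), z)` for the Christoffel
symbols `Γ` of a metric `g`. -/
noncomputable def koszul (g : F → F →L[ℝ] F →L[ℝ] ℝ) (y u v : F) : F →L[ℝ] ℝ :=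
  (1 / 2 : ℝ) • (fderiv ℝ g y u v + fderiv ℝ g y v u - ((fderiv ℝ g y).flip u).flip v)

theorem koszul_apply (g : F → F →L[ℝ] F →L[ℝ] ℝ) (y u v z : F) :
    koszul g y u v z =
      1 / 2 * (fderiv ℝ g y u v z + fderiv ℝ g y v u z - fderiv ℝ g y z u v) := by
  simp [koszul]

/-- The Koszul expression of the pullback `g = τ^* h`. Apart from the pullback of the Koszul
expression of `h` it contains the second derivative of `τ`. -/
theorem koszul_pullback {g h : F → F →L[ℝ] F →L[ℝ] ℝ} {τ : F → F} {y : F}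
    (hτ : ContDiffAt ℝ 2 τ y) (hh : DifferentiableAt ℝ h (τ y))
    (hsymm : ∀ u v, h (τ y) u v = h (τ y) v u)
    (hg : ∀ᶠ z in 𝓝 y, ∀ u v, g z u v = h (τ z) (fderiv ℝ τ z u) (fderiv ℝ τ z v))
    (hgd : DifferentiableAt ℝ g y) (u v z : F) :
    koszul g y u v z =
      koszul h (τ y) (fderiv ℝ τ y u) (fderiv ℝ τ y v) (fderiv ℝ τ y z)
        + h (τ y) (fderiv ℝ (fderiv ℝ τ) y u v) (fderiv ℝ τ y z) := by
  have hd1 : DifferentiableAt ℝ τ y := hτ.differentiableAt (by norm_num)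
  have hd2 : DifferentiableAt ℝ (fderiv ℝ τ) y :=
    (hτ.fderiv_right (m := 1) (by norm_num)).differentiableAt (by norm_num)
  -- The product rule for `g z u v = h (τ z) (τ' z u) (τ' z v)`.
  have key : ∀ w u v, fderiv ℝ g y w u v =
      fderiv ℝ h (τ y) (fderiv ℝ τ y w) (fderiv ℝ τ y u) (fderiv ℝ τ y v)
      + h (τ y) (fderiv ℝ (fderiv ℝ τ) y w u) (fderiv ℝ τ y v)
      + h (τ y) (fderiv ℝ τ y u) (fderiv ℝ (fderiv ℝ τ) y w v) := by
    intro w u v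
    have hu : ∀ u, HasFDerivAt (fun z ↦ fderiv ℝ τ z u) ((fderiv ℝ (fderiv ℝ τ) y).flip u) y := by
      intro u
      have := hd2.hasFDerivAt.clm_apply (hasFDerivAt_const u y)
      convert this using 1
      ext; simp
    have h0 : HasFDerivAt (fun z ↦ h (τ z)) ((fderiv ℝ h (τ y)).comp (fderiv ℝ τ y)) y :=
      hh.hasFDerivAt.comp y hd1.hasFDerivAt
    have h1 := (h0.clm_apply (hu u)).clm_apply (hu v)
    have h2 := (hgd.hasFDerivAt.clm_apply (hasFDerivAt_const u y)).clm_apply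
      (hasFDerivAt_const v y)
    have h3 := h2.unique (h1.congr_of_eventuallyEq (hg.mono fun z hz ↦ hz u v))
    have h4 := congrArg (fun L ↦ L w) h3
    simp at h4
    linarith
  have hs : ∀ a b, fderiv ℝ (fderiv ℝ τ) y a b = fderiv ℝ (fderiv ℝ τ) y b a :=
    (hτ.isSymmSndFDerivAt (by simp)).eq
  rw [koszul_apply, koszul_apply, key, key, key, hs v u, hs z u, hs z v,
    hsymm (fderiv ℝ τ y v), hsymm (fderiv ℝ (fderiv ℝ τ) y u z)]
  ring

end Calculus

/-! ### The metric and the Christoffel symbols in a chart -/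

section Chart

variable {E : Type*} [NormedAddCommGroup E] [NormedSpace ℝ E]
  {M : Type*} [TopologicalSpace M] [ChartedSpace E M] [IsManifold 𝓘(ℝ, E) ∞ M]

theorem isInvertible_chartFrame (x₀ : M) {y : E} (hy : y ∈ (extChartAt 𝓘(ℝ, E) x₀).target) :
    (chartFrame x₀ y).IsInvertible := by
  have := isInvertible_mfderivWithin_extChartAt_symm (I := 𝓘(ℝ, E)) hy
  simpa [mfderivWithin_univ] using! this

/-- The coordinate vector fields of a chart are smooth. -/
theorem contMDiffOn_chartFrame (x₀ : M) (u : E) :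
    ContMDiffOn 𝓘(ℝ, E) (𝓘(ℝ, E).prod 𝓘(ℝ, E)) ∞
      (fun y ↦ (⟨(extChartAt 𝓘(ℝ, E) x₀).symm y, chartFrame x₀ y u⟩ : TangentBundle 𝓘(ℝ, E) M))
      (extChartAt 𝓘(ℝ, E) x₀).target := by
  have ho : IsOpen (extChartAt 𝓘(ℝ, E) x₀).target := isOpen_extChartAt_target x₀
  have h := (contMDiffOn_extChartAt_symm (I := 𝓘(ℝ, E)) (n := ∞) x₀).contMDiffOn_tangentMapWithin
    (m := ∞) (by simp) ho.uniqueMDiffOn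
  have hs : ContMDiffOn 𝓘(ℝ, E) (𝓘(ℝ, E).prod 𝓘(ℝ, E)) ∞
      (fun y ↦ (⟨y, u⟩ : TangentBundle 𝓘(ℝ, E) E)) (extChartAt 𝓘(ℝ, E) x₀).target := by
    intro y hy
    rw [Bundle.contMDiffWithinAt_totalSpace]
    refine ⟨contMDiffWithinAt_id, ?_⟩
    simpa using! contMDiffWithinAt_const
  refine (h.comp hs fun y hy ↦ hy).congr fun y hy ↦ ?_
  simp only [tangentMapWithin, Function.comp_apply, chartFrame]
  rw [mfderivWithin_of_isOpen ho hy]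
  rfl

variable [Bundle.RiemannianBundle (fun x : M ↦ TangentSpace 𝓘(ℝ, E) x)]

theorem chartMetric_symm (x₀ : M) (y u v : E) :
    chartMetric x₀ y u v = chartMetric x₀ y v u := by
  rw [chartMetric_apply, chartMetric_apply, real_inner_comm]

theorem christoffel_eq (x₀ : M) (y u v : E) :
    christoffel x₀ y u v = (chartMetric x₀ y).inverse (koszul (chartMetric x₀) y u v) :=
  rfl

variable [FiniteDimensional ℝ E]

theorem isInvertible_chartMetric (x₀ : M) {y : E} (hy : y ∈ (extChartAt 𝓘(ℝ, E) x₀).target) :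
    (chartMetric x₀ y).IsInvertible := by
  have hinj : Function.Injective (chartMetric x₀ y) := by
    refine (injective_iff_map_eq_zero _).2 fun u hu ↦ ?_
    have h : chartMetric x₀ y u u = 0 := by rw [hu]; rfl
    rw [chartMetric_apply, inner_self_eq_zero] at h
    exact (isInvertible_chartFrame x₀ hy).injective (h.trans (map_zero _).symm)
  have hfin : Module.finrank ℝ E = Module.finrank ℝ (E →L[ℝ] ℝ) := by
    rw [← LinearMap.toContinuousLinearMap.finrank_eq]
    exact (Subspace.dual_finrank_eq).symm
  exact ⟨(LinearEquiv.ofInjectiveOfFinrankEq (chartMetric x₀ y).toLinearMap hinj hfin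
    ).toContinuousLinearEquiv, by ext; rfl⟩

/-- At a point of the chart the Christoffel symbols satisfy their defining equation. -/
theorem chartMetric_christoffel (x₀ : M) {y : E}
    (hy : y ∈ (extChartAt 𝓘(ℝ, E) x₀).target) (u v : E) :
    chartMetric x₀ y (christoffel x₀ y u v) = koszul (chartMetric x₀) y u v := by
  rw [christoffel_eq, (isInvertible_chartMetric x₀ hy).self_apply_inverse]

variable [IsContMDiffRiemannianBundle 𝓘(ℝ, E) ∞ E (fun x : M ↦ TangentSpace 𝓘(ℝ, E) x)]

theorem contDiffOn_chartMetric (x₀ : M) :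
    ContDiffOn ℝ ∞ (chartMetric x₀) (extChartAt 𝓘(ℝ, E) x₀).target := by
  rw [contDiffOn_clm_apply]
  intro u
  rw [contDiffOn_clm_apply]
  intro v
  have h := ContMDiffOn.inner_bundle (IM := 𝓘(ℝ, E)) (IB := 𝓘(ℝ, E)) (n := ∞) (F := E)
    (E := fun p : M ↦ TangentSpace 𝓘(ℝ, E) p) (s := (extChartAt 𝓘(ℝ, E) x₀).target)
    (b := (extChartAt 𝓘(ℝ, E) x₀).symm) (v := fun y ↦ chartFrame x₀ y u)
    (w := fun y ↦ chartFrame x₀ y v)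
  exact (h (contMDiffOn_chartFrame x₀ u) (contMDiffOn_chartFrame x₀ v)).contDiffOn

theorem contDiffAt_chartMetric (x₀ : M) {y : E} (hy : y ∈ (extChartAt 𝓘(ℝ, E) x₀).target) :
    ContDiffAt ℝ ∞ (chartMetric x₀) y :=
  (contDiffOn_chartMetric x₀).contDiffAt ((isOpen_extChartAt_target x₀).mem_nhds hy)

/-- The Christoffel term `v ↦ Γ(u, v)` as a continuous linear map. -/
noncomputable def christoffelCLM (x₀ : M) (y u : E) : E →L[ℝ] E :=
  LinearMap.toContinuousLinearMap
    { toFun := christoffel x₀ y u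
      map_add' := fun v w ↦ by
        simp only [christoffel, ← map_add]
        congr 1
        ext z
        simp
        ring
      map_smul' := fun c v ↦ by
        simp only [christoffel, ← map_smul, RingHom.id_apply]
        congr 1
        ext z
        simp
        ring }

@[simp] theorem christoffelCLM_apply (x₀ : M) (y u v : E) :
    christoffelCLM x₀ y u v = christoffel x₀ y u v :=
  rfl

theorem christoffel_zero_left (x₀ : M) (y v : E) : christoffel x₀ y 0 v = 0 := by
  simp only [christoffel]
  rw [← map_zero (chartMetric x₀ y).inverse]
  congr 1
  ext z
  simp

theorem continuousOn_christoffelCLM (x₀ : M) {S : Set ℝ} {x u : ℝ → E}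
    (hx : ContinuousOn x S) (hu : ContinuousOn u S)
    (hxS : ∀ t ∈ S, x t ∈ (extChartAt 𝓘(ℝ, E) x₀).target) :
    ContinuousOn (fun t ↦ christoffelCLM x₀ (x t) (u t)) S := by
  have ho : IsOpen (extChartAt 𝓘(ℝ, E) x₀).target := isOpen_extChartAt_target x₀
  rw [continuousOn_clm_apply]
  intro v
  simp only [christoffelCLM_apply, christoffel_eq]
  have hg : ContinuousOn (fun t ↦ (chartMetric x₀ (x t)).inverse) S := by
    intro t ht
    exact ((isInvertible_chartMetric x₀ (hxS t ht)).contDiffAt_map_inverse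
      (n := 0)).continuousAt.comp_continuousWithinAt
        (f := fun t ↦ chartMetric x₀ (x t))
        ((contDiffOn_chartMetric x₀).continuousOn.comp hx hxS t ht)
  have hd : ContinuousOn (fun t ↦ fderiv ℝ (chartMetric x₀) (x t)) S :=
    ((contDiffOn_chartMetric x₀).continuousOn_fderiv_of_isOpen ho (by simp)).comp hx hxS
  refine hg.clm_apply ?_
  rw [continuousOn_clm_apply]
  intro z
  simp only [koszul_apply]
  have h1 := (((hd.clm_apply hu).clm_apply continuousOn_const (g := fun _ ↦ v)).clm_apply
    continuousOn_const (g := fun _ ↦ z))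
  have h2 := (((hd.clm_apply continuousOn_const (g := fun _ ↦ v)).clm_apply hu).clm_apply
    continuousOn_const (g := fun _ ↦ z))
  have h3 := (((hd.clm_apply continuousOn_const (g := fun _ ↦ z)).clm_apply hu).clm_apply
    continuousOn_const (g := fun _ ↦ v))
  exact continuousOn_const.mul ((h1.add h2).sub h3)

end Chart

/-! ### Change of charts -/

section Transition

variable {E : Type*} [NormedAddCommGroup E] [NormedSpace ℝ E]
  {M : Type*} [TopologicalSpace M] [ChartedSpace E M]

/-- The change of coordinates from the chart around `x₀` to the chart around `x₁`. -/
noncomputable def transition (x₀ x₁ : M) (y : E) : E :=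
  extChartAt 𝓘(ℝ, E) x₁ ((extChartAt 𝓘(ℝ, E) x₀).symm y)

variable [IsManifold 𝓘(ℝ, E) ∞ M]

theorem mdifferentiableAt_extChartAt_symm (x₀ : M) {y : E}
    (hy : y ∈ (extChartAt 𝓘(ℝ, E) x₀).target) :
    MDifferentiableAt 𝓘(ℝ, E) 𝓘(ℝ, E) (extChartAt 𝓘(ℝ, E) x₀).symm y := by
  have h := mdifferentiableWithinAt_extChartAt_symm (I := 𝓘(ℝ, E)) hy
  simpa [mdifferentiableWithinAt_univ] using h

theorem mdifferentiableAt_extChartAt_of_mem_source {x₀ p : M}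
    (hp : p ∈ (extChartAt 𝓘(ℝ, E) x₀).source) :
    MDifferentiableAt 𝓘(ℝ, E) 𝓘(ℝ, E) (extChartAt 𝓘(ℝ, E) x₀) p :=
  mdifferentiableAt_extChartAt (by rwa [extChartAt_source] at hp)

theorem contDiffAt_transition {x₀ x₁ : M} {y : E} (hy : y ∈ (extChartAt 𝓘(ℝ, E) x₀).target)
    (hy₁ : (extChartAt 𝓘(ℝ, E) x₀).symm y ∈ (extChartAt 𝓘(ℝ, E) x₁).source) :
    ContDiffAt ℝ ∞ (transition x₀ x₁) y := by
  rw [← contMDiffAt_iff_contDiffAt]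
  have h₀ : ContMDiffAt 𝓘(ℝ, E) 𝓘(ℝ, E) ∞ (extChartAt 𝓘(ℝ, E) x₀).symm y :=
    (contMDiffOn_extChartAt_symm x₀).contMDiffAt ((isOpen_extChartAt_target x₀).mem_nhds hy)
  have h₁ : ContMDiffAt 𝓘(ℝ, E) 𝓘(ℝ, E) ∞ (extChartAt 𝓘(ℝ, E) x₁)
      ((extChartAt 𝓘(ℝ, E) x₀).symm y) :=
    contMDiffAt_extChartAt' (by rwa [extChartAt_source] at hy₁)
  exact h₁.comp y h₀

theorem eventually_mem_transition_domain {x₀ x₁ : M} {y : E}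
    (hy : y ∈ (extChartAt 𝓘(ℝ, E) x₀).target)
    (hy₁ : (extChartAt 𝓘(ℝ, E) x₀).symm y ∈ (extChartAt 𝓘(ℝ, E) x₁).source) :
    ∀ᶠ z in 𝓝 y, z ∈ (extChartAt 𝓘(ℝ, E) x₀).target ∧
      (extChartAt 𝓘(ℝ, E) x₀).symm z ∈ (extChartAt 𝓘(ℝ, E) x₁).source := by
  have h : ∀ᶠ z in 𝓝 y, z ∈ (extChartAt 𝓘(ℝ, E) x₀).target :=
    (isOpen_extChartAt_target x₀).mem_nhds hy
  exact h.and ((mdifferentiableAt_extChartAt_symm x₀ hy).continuousAt.eventually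
    ((isOpen_extChartAt_source x₁).mem_nhds hy₁))

/-- The coordinate frames of two charts are related by the differential of the change of
coordinates. Both sides are read in the model space `E`, since the base points agree only
propositionally. -/
theorem chartFrame_transition {x₀ x₁ : M} {y : E} (hy : y ∈ (extChartAt 𝓘(ℝ, E) x₀).target)
    (hy₁ : (extChartAt 𝓘(ℝ, E) x₀).symm y ∈ (extChartAt 𝓘(ℝ, E) x₁).source) (u : E) :
    (chartFrame x₁ (transition x₀ x₁ y) (fderiv ℝ (transition x₀ x₁) y u) : E) =
      (chartFrame x₀ y u : E) := by
  have hτ :=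
    ((contDiffAt_transition hy hy₁).differentiableAt (by simp)).hasFDerivAt.hasMFDerivAt
  have h₁ := (mdifferentiableAt_extChartAt_symm x₁
    ((extChartAt 𝓘(ℝ, E) x₁).map_source hy₁)).hasMFDerivAt
  have hc := HasMFDerivAt.comp (f := transition x₀ x₁) y h₁ hτ
  have h₀ : HasMFDerivAt 𝓘(ℝ, E) 𝓘(ℝ, E)
      ((extChartAt 𝓘(ℝ, E) x₁).symm ∘ transition x₀ x₁) y (chartFrame x₀ y) := by
    refine (mdifferentiableAt_extChartAt_symm x₀ hy).hasMFDerivAt.congr_of_eventuallyEq ?_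
    filter_upwards [eventually_mem_transition_domain hy hy₁] with z hz
    exact (extChartAt 𝓘(ℝ, E) x₁).left_inv hz.2
  exact congrArg (fun L : E →L[ℝ] E ↦ L u) (hasMFDerivAt_unique hc h₀)

/-- The coordinates of a tangent vector in two charts are related by the differential of the change
of coordinates. -/
theorem chartCoord_transition {x₀ x₁ p : M} (hp₀ : p ∈ (extChartAt 𝓘(ℝ, E) x₀).source)
    (hp₁ : p ∈ (extChartAt 𝓘(ℝ, E) x₁).source) (v : TangentSpace 𝓘(ℝ, E) p) :
    chartCoord x₁ v =
      fderiv ℝ (transition x₀ x₁) (extChartAt 𝓘(ℝ, E) x₀ p) (chartCoord x₀ v) := by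
  have hy := (extChartAt 𝓘(ℝ, E) x₀).map_source hp₀
  have hy₁ : (extChartAt 𝓘(ℝ, E) x₀).symm (extChartAt 𝓘(ℝ, E) x₀ p) ∈
      (extChartAt 𝓘(ℝ, E) x₁).source := by rwa [(extChartAt 𝓘(ℝ, E) x₀).left_inv hp₀]
  have hτ :=
    ((contDiffAt_transition hy hy₁).differentiableAt (by simp)).hasFDerivAt.hasMFDerivAt
  have hc := HasMFDerivAt.comp p hτ (mdifferentiableAt_extChartAt_of_mem_source hp₀).hasMFDerivAt
  have h₁ : HasMFDerivAt 𝓘(ℝ, E) 𝓘(ℝ, E) (transition x₀ x₁ ∘ extChartAt 𝓘(ℝ, E) x₀) p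
      (mfderiv 𝓘(ℝ, E) 𝓘(ℝ, E) (extChartAt 𝓘(ℝ, E) x₁) p) := by
    refine (mdifferentiableAt_extChartAt_of_mem_source hp₁).hasMFDerivAt.congr_of_eventuallyEq ?_
    filter_upwards [(isOpen_extChartAt_source x₀).mem_nhds hp₀] with q hq
    simp only [transition, Function.comp_apply]
    rw [(extChartAt 𝓘(ℝ, E) x₀).left_inv hq]
  exact congrArg (fun L : E →L[ℝ] E ↦ L v) (hasMFDerivAt_unique h₁ hc)

theorem bijective_chartCoord {x₀ p : M} (hp : p ∈ (extChartAt 𝓘(ℝ, E) x₀).source) :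
    Function.Bijective (chartCoord x₀ : TangentSpace 𝓘(ℝ, E) p → E) :=
  (isInvertible_mfderiv_extChartAt hp).bijective

theorem bijective_fderiv_transition {x₀ x₁ p : M} (hp₀ : p ∈ (extChartAt 𝓘(ℝ, E) x₀).source)
    (hp₁ : p ∈ (extChartAt 𝓘(ℝ, E) x₁).source) :
    Function.Bijective (fderiv ℝ (transition x₀ x₁) (extChartAt 𝓘(ℝ, E) x₀ p)) := by
  have h : (fderiv ℝ (transition x₀ x₁) (extChartAt 𝓘(ℝ, E) x₀ p)) ∘
      (chartCoord x₀ : TangentSpace 𝓘(ℝ, E) p → E) = chartCoord x₁ :=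
    funext fun v ↦ (chartCoord_transition hp₀ hp₁ v).symm
  exact (Function.Bijective.of_comp_iff _ (bijective_chartCoord hp₀)).1
    (h ▸ bijective_chartCoord hp₁)

variable [Bundle.RiemannianBundle (fun x : M ↦ TangentSpace 𝓘(ℝ, E) x)]

theorem chartMetric_transition {x₀ x₁ : M} {y : E} (hy : y ∈ (extChartAt 𝓘(ℝ, E) x₀).target)
    (hy₁ : (extChartAt 𝓘(ℝ, E) x₀).symm y ∈ (extChartAt 𝓘(ℝ, E) x₁).source) (u v : E) :
    chartMetric x₀ y u v = chartMetric x₁ (transition x₀ x₁ y)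
      (fderiv ℝ (transition x₀ x₁) y u) (fderiv ℝ (transition x₀ x₁) y v) := by
  -- The two inner products live in tangent spaces at points that are equal, but not by definition.
  have key : ∀ (p q : M) (_ : p = q) (w z : E),
      inner ℝ (E := TangentSpace 𝓘(ℝ, E) p) w z = inner ℝ (E := TangentSpace 𝓘(ℝ, E) q) w z := by
    rintro p _ rfl w z
    rfl
  rw [chartMetric_apply, chartMetric_apply]
  refine (key _ _ ((extChartAt 𝓘(ℝ, E) x₁).left_inv hy₁).symm _ _).trans ?_
  exact congrArg₂ (fun w z : E ↦ inner ℝ (E := TangentSpace 𝓘(ℝ, E) _) w z)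
    (chartFrame_transition hy hy₁ u).symm
    (chartFrame_transition hy hy₁ v).symm

variable [FiniteDimensional ℝ E]
  [IsContMDiffRiemannianBundle 𝓘(ℝ, E) ∞ E (fun x : M ↦ TangentSpace 𝓘(ℝ, E) x)]

/-- The transformation law of the Christoffel symbols under a change of coordinates. -/
theorem christoffel_transition {x₀ x₁ p : M} (hp₀ : p ∈ (extChartAt 𝓘(ℝ, E) x₀).source)
    (hp₁ : p ∈ (extChartAt 𝓘(ℝ, E) x₁).source) (u v : E) :
    fderiv ℝ (transition x₀ x₁) (extChartAt 𝓘(ℝ, E) x₀ p)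
        (christoffel x₀ (extChartAt 𝓘(ℝ, E) x₀ p) u v) =
      christoffel x₁ (extChartAt 𝓘(ℝ, E) x₁ p)
          (fderiv ℝ (transition x₀ x₁) (extChartAt 𝓘(ℝ, E) x₀ p) u)
          (fderiv ℝ (transition x₀ x₁) (extChartAt 𝓘(ℝ, E) x₀ p) v)
        + fderiv ℝ (fderiv ℝ (transition x₀ x₁)) (extChartAt 𝓘(ℝ, E) x₀ p) u v := by
  have hτp : transition x₀ x₁ (extChartAt 𝓘(ℝ, E) x₀ p) = extChartAt 𝓘(ℝ, E) x₁ p := by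
    rw [transition, (extChartAt 𝓘(ℝ, E) x₀).left_inv hp₀]
  have hy := (extChartAt 𝓘(ℝ, E) x₀).map_source hp₀
  have hz := (extChartAt 𝓘(ℝ, E) x₁).map_source hp₁
  have hy₁ : (extChartAt 𝓘(ℝ, E) x₀).symm (extChartAt 𝓘(ℝ, E) x₀ p) ∈
      (extChartAt 𝓘(ℝ, E) x₁).source := by rwa [(extChartAt 𝓘(ℝ, E) x₀).left_inv hp₀]
  have hbij := bijective_fderiv_transition hp₀ hp₁
  set y := extChartAt 𝓘(ℝ, E) x₀ p
  rw [← hτp] at hz ⊢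
  refine (isInvertible_chartMetric x₁ hz).injective ?_
  ext z'
  obtain ⟨z, rfl⟩ := hbij.2 z'
  rw [← chartMetric_transition hy hy₁, chartMetric_christoffel x₀ hy, map_add,
    chartMetric_christoffel x₁ hz, add_apply]
  refine koszul_pullback
    ((contDiffAt_transition hy hy₁).of_le (WithTop.coe_le_coe.2 (le_top : (2 : ℕ∞) ≤ ⊤)))
    ((contDiffAt_chartMetric x₁ hz).differentiableAt (by simp)) (chartMetric_symm x₁ _) ?_
    ((contDiffAt_chartMetric x₀ hy).differentiableAt (by simp)) u v z
  filter_upwards [eventually_mem_transition_domain hy hy₁] with w hw u v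
  exact chartMetric_transition hw.1 hw.2 u v

/-- The defining formula of the covariant derivative along a curve, which uses the chart around
`X t` at time `t`, holds in every chart that contains `X t`. -/
theorem chartCoord_covDerivAlong {S : Set ℝ} {X : ℝ → M} {A : (t : ℝ) → TangentSpace 𝓘(ℝ, E) (X t)}
    {t : ℝ} {x₀ : M} (hS : UniqueDiffWithinAt ℝ S t) (htS : t ∈ S) (hX : ContinuousWithinAt X S t)
    (ht : X t ∈ (extChartAt 𝓘(ℝ, E) x₀).source)
    (hx : DifferentiableWithinAt ℝ (fun s ↦ extChartAt 𝓘(ℝ, E) x₀ (X s)) S t)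
    (hα : DifferentiableWithinAt ℝ (fun s ↦ chartCoord x₀ (A s)) S t) :
    chartCoord x₀ (covDerivAlong S X A t) =
      derivWithin (fun s ↦ chartCoord x₀ (A s)) S t +
        christoffel x₀ (extChartAt 𝓘(ℝ, E) x₀ (X t))
          (derivWithin (fun s ↦ extChartAt 𝓘(ℝ, E) x₀ (X s)) S t) (chartCoord x₀ (A t)) := by
  have ht₁ : X t ∈ (extChartAt 𝓘(ℝ, E) (X t)).source := mem_extChartAt_source (X t)
  have hbij := bijective_fderiv_transition ht ht₁
  have hy := (extChartAt 𝓘(ℝ, E) x₀).map_source ht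
  have hy₁ : (extChartAt 𝓘(ℝ, E) x₀).symm (extChartAt 𝓘(ℝ, E) x₀ (X t)) ∈
      (extChartAt 𝓘(ℝ, E) (X t)).source := by rwa [(extChartAt 𝓘(ℝ, E) x₀).left_inv ht]
  have hτ := contDiffAt_transition hy hy₁
  have hτ₁ : HasFDerivAt (transition x₀ (X t)) _ (extChartAt 𝓘(ℝ, E) x₀ (X t)) :=
    (hτ.differentiableAt (by simp)).hasFDerivAt
  have hτ₂ : HasFDerivAt (fderiv ℝ (transition x₀ (X t))) _ (extChartAt 𝓘(ℝ, E) x₀ (X t)) :=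
    ((hτ.fderiv_right (m := ∞) (by simp)).differentiableAt (by simp)).hasFDerivAt
  have hev : ∀ᶠ s in 𝓝[S] t, X s ∈ (extChartAt 𝓘(ℝ, E) x₀).source ∧
      X s ∈ (extChartAt 𝓘(ℝ, E) (X t)).source :=
    (hX.eventually ((isOpen_extChartAt_source x₀).mem_nhds ht)).and
      (hX.eventually ((isOpen_extChartAt_source (X t)).mem_nhds ht₁))
  have hx₁ : HasDerivWithinAt (fun s ↦ extChartAt 𝓘(ℝ, E) (X t) (X s)) _ S t :=
    (hτ₁.comp_hasDerivWithinAt (f := fun s ↦ extChartAt 𝓘(ℝ, E) x₀ (X s)) t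
      hx.hasDerivWithinAt).congr_of_eventuallyEq_of_mem (hev.mono fun s hs ↦ by
        simp only [Function.comp_apply, transition]
        rw [(extChartAt 𝓘(ℝ, E) x₀).left_inv hs.1]) htS
  have hα₁ : HasDerivWithinAt (fun s ↦ chartCoord (X t) (A s)) _ S t :=
    ((hτ₂.comp_hasDerivWithinAt (f := fun s ↦ extChartAt 𝓘(ℝ, E) x₀ (X s)) t
      hx.hasDerivWithinAt).clm_apply hα.hasDerivWithinAt).congr_of_eventuallyEq_of_mem
      (hev.mono fun s hs ↦ chartCoord_transition hs.1 hs.2 (A s)) htS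
  -- After the differential of the transition map is applied, both sides are the expression in the
  -- chart around `X t`: the second derivatives from `hα₁` and from the Christoffel symbols cancel.
  refine hbij.1 ?_
  rw [← chartCoord_transition ht ht₁, map_add, christoffel_transition ht ht₁,
    ← chartCoord_transition ht ht₁ (A t), ← hx₁.derivWithin hS]
  have h := (isInvertible_mfderiv_extChartAt (I := 𝓘(ℝ, E)) ht₁).self_apply_inverse
    (derivWithin (fun s ↦ chartCoord (X t) (A s)) S t + christoffel (X t)
      (extChartAt 𝓘(ℝ, E) (X t) (X t)) (derivWithin (fun s ↦ extChartAt 𝓘(ℝ, E) (X t) (X s)) S t)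
      (chartCoord (X t) (A t)))
  refine Eq.trans h ?_
  rw [hα₁.derivWithin hS]
  simp only [Function.comp_apply]
  abel

end Transition

/-! ### Parallel coframes along a curve -/

section Coframe

variable {E : Type*} [NormedAddCommGroup E] [NormedSpace ℝ E]
  {M : Type*} [TopologicalSpace M] [ChartedSpace E M] [IsManifold 𝓘(ℝ, E) ∞ M]
  [Bundle.RiemannianBundle (fun x : M ↦ TangentSpace 𝓘(ℝ, E) x)]

/-- `A` is a vector field of class `C^1` along `X : S → M` near `t`. -/
def IsC1FieldAt (S : Set ℝ) (X : ℝ → M) (A : (t : ℝ) → TangentSpace 𝓘(ℝ, E) (X t)) (t : ℝ) :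
    Prop :=
  ContMDiffWithinAt 𝓘(ℝ, ℝ) (𝓘(ℝ, E).prod 𝓘(ℝ, E)) 1
    (fun t ↦ (⟨X t, A t⟩ : TangentBundle 𝓘(ℝ, E) M)) S t

/-- `G` is, near `t`, a parallel coframe along the curve `X : S → M`: the maps `G s` identify the
tangent spaces along `X` with the model space `E`, in such a way that `C^1` fields along `X` become
`C^1` functions and the covariant derivative becomes the ordinary derivative. -/
structure IsParallelCoframeAt (S : Set ℝ) (X : ℝ → M)
    (G : (t : ℝ) → TangentSpace 𝓘(ℝ, E) (X t) →L[ℝ] E) (t : ℝ) : Prop where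
  isInvertible : (G t).IsInvertible
  isC1FieldAt_iff : ∀ A : (t : ℝ) → TangentSpace 𝓘(ℝ, E) (X t),
    IsC1FieldAt S X A t ↔ ContDiffWithinAt ℝ 1 (fun s ↦ G s (A s)) S t
  hasDerivWithinAt : ∀ A : (t : ℝ) → TangentSpace 𝓘(ℝ, E) (X t), IsC1FieldAt S X A t →
    HasDerivWithinAt (fun s ↦ G s (A s)) (G t (covDerivAlong S X A t)) S t

variable {S : Set ℝ} {X : ℝ → M} {G G' : (t : ℝ) → TangentSpace 𝓘(ℝ, E) (X t) →L[ℝ] E} {t : ℝ}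

theorem IsParallelCoframeAt.congr (hG : IsParallelCoframeAt S X G t) (ht : t ∈ S)
    (h : ∀ᶠ s in 𝓝[S] t, G' s = G s) : IsParallelCoframeAt S X G' t := by
  have ht' : G' t = G t := h.self_of_nhdsWithin ht
  have hA : ∀ A : (t : ℝ) → TangentSpace 𝓘(ℝ, E) (X t),
      (fun s ↦ G' s (A s)) =ᶠ[𝓝[S] t] fun s ↦ G s (A s) := fun A ↦
    h.mono fun s hs ↦ by simp only [hs]
  refine ⟨ht' ▸ hG.isInvertible, fun A ↦ (hG.isC1FieldAt_iff A).trans ?_, fun A h ↦ ?_⟩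
  · exact ⟨fun h ↦ h.congr_of_eventuallyEq_of_mem (hA A) ht,
      fun h ↦ h.congr_of_eventuallyEq_of_mem (hA A).symm ht⟩
  · rw [ht']
    exact (hG.hasDerivWithinAt A h).congr_of_eventuallyEq_of_mem (hA A) ht

theorem IsParallelCoframeAt.clm_comp (hG : IsParallelCoframeAt S X G t) {C : E →L[ℝ] E}
    (hC : C.IsInvertible) : IsParallelCoframeAt S X (fun s ↦ C ∘L G s) t := by
  refine ⟨hC.comp hG.isInvertible, fun A ↦ (hG.isC1FieldAt_iff A).trans ⟨fun h ↦ ?_, fun h ↦ ?_⟩,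
    fun A h ↦ ?_⟩
  · exact C.contDiff.comp_contDiffWithinAt h
  · refine (C.inverse.contDiff.comp_contDiffWithinAt h).congr_of_eventuallyEq
      (Eventually.of_forall fun s ↦ ?_) ?_ <;>
    simp [hC.inverse_apply_self]
  · exact C.hasFDerivAt.comp_hasDerivWithinAt t (hG.hasDerivWithinAt A h)

theorem IsParallelCoframeAt.covDerivAlong_eq_zero (hG : IsParallelCoframeAt S X G t)
    (hS : UniqueDiffWithinAt ℝ S t) {A : (t : ℝ) → TangentSpace 𝓘(ℝ, E) (X t)}
    (hA : IsC1FieldAt S X A t) (h : HasDerivWithinAt (fun s ↦ G s (A s)) 0 S t) :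
    covDerivAlong S X A t = 0 :=
  hG.isInvertible.injective
    ((hS.eq_deriv _ (hG.hasDerivWithinAt A hA) h).trans (map_zero _).symm)

/-- A field whose coordinates in a parallel coframe are constant is parallel. -/
theorem IsParallelCoframeAt.parallel_of_eventually_const (hG : IsParallelCoframeAt S X G t)
    (ht : t ∈ S) (hS : UniqueDiffWithinAt ℝ S t) {A : (t : ℝ) → TangentSpace 𝓘(ℝ, E) (X t)} {c : E}
    (h : ∀ᶠ s in 𝓝[S] t, G s (A s) = c) : IsC1FieldAt S X A t ∧ covDerivAlong S X A t = 0 := by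
  have hA : IsC1FieldAt S X A t := (hG.isC1FieldAt_iff A).2
    ((contDiffWithinAt_const (c := c)).congr_of_eventuallyEq_of_mem h ht)
  exact ⟨hA, hG.covDerivAlong_eq_zero hS hA
    ((hasDerivWithinAt_const t S c).congr_of_eventuallyEq_of_mem h ht)⟩

/-- A parallel field has constant coordinates in a parallel coframe. -/
theorem coframe_apply_parallel_eq {I : Set ℝ} (hI : Convex ℝ I) (hIS : I ⊆ S)
    (hG : ∀ r ∈ I, IsParallelCoframeAt S X G r) {A : (t : ℝ) → TangentSpace 𝓘(ℝ, E) (X t)}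
    (hA : ∀ r ∈ I, IsC1FieldAt S X A r) (hA' : ∀ r ∈ I, covDerivAlong S X A r = 0)
    {r s : ℝ} (hr : r ∈ I) (hs : s ∈ I) : G r (A r) = G s (A s) := by
  have hd : ∀ r ∈ I, HasDerivWithinAt (fun s ↦ G s (A s)) ((fun _ ↦ (0 : E)) r) I r := by
    intro r hr
    have h := (hG r hr).hasDerivWithinAt A (hA r hr)
    rw [hA' r hr, map_zero] at h
    exact h.mono hIS
  have h := hI.norm_image_sub_le_of_norm_hasDerivWithin_le (C := 0) hd (by simp) hs hr
  rw [zero_mul, norm_le_zero_iff, sub_eq_zero] at h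
  exact h

/-- Two parallel coframes on an interval differ by a constant automorphism of `E`. -/
theorem coframe_eq_comp {I : Set ℝ} (hI : Convex ℝ I) (hIS : I ⊆ S)
    (hIn : ∀ r ∈ I, I ∈ 𝓝[S] r) (hS : UniqueDiffOn ℝ S)
    (hG : ∀ r ∈ I, IsParallelCoframeAt S X G r) (hG' : ∀ r ∈ I, IsParallelCoframeAt S X G' r)
    {r s : ℝ} (hr : r ∈ I) (hs : s ∈ I) :
    G s = (G r ∘L (G' r).inverse) ∘L G' s := by
  ext v
  -- The field with constant coordinates `G' s v` in `G'` is parallel, and hence has constant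
  -- coordinates in `G`.
  set A : (t : ℝ) → TangentSpace 𝓘(ℝ, E) (X t) := fun q ↦ (G' q).inverse (G' s v) with hA
  have hp : ∀ q ∈ I, IsC1FieldAt S X A q ∧ covDerivAlong S X A q = 0 := fun q hq ↦
    (hG' q hq).parallel_of_eventually_const (hIS hq) (hS q (hIS hq)) (c := G' s v)
      (Filter.mem_of_superset (hIn q hq) fun p hp ↦
        (hG' p hp).isInvertible.self_apply_inverse (G' s v))
  have h := coframe_apply_parallel_eq hI hIS hG (fun q hq ↦ (hp q hq).1)
    (fun q hq ↦ (hp q hq).2) hs hr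
  have hv : A s = v := (hG' s hs).isInvertible.inverse_apply_self v
  rw [hv] at h
  exact h

/-- Two parallel coframes over overlapping intervals can be glued. -/
theorem exists_coframe_glue (hSc : Convex ℝ S) (hS : UniqueDiffOn ℝ S) {c d e t₁ : ℝ}
    (ht₁ : t₁ ∈ S) (hc : c < t₁) (hd : t₁ < d) (he : t₁ < e)
    (hG : ∀ t ∈ S ∩ Iio d, IsParallelCoframeAt S X G t)
    (hG' : ∀ t ∈ S ∩ Ioo c e, IsParallelCoframeAt S X G' t) :
    ∃ G'' : (t : ℝ) → TangentSpace 𝓘(ℝ, E) (X t) →L[ℝ] E,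
      ∀ t ∈ S ∩ Iio e, IsParallelCoframeAt S X G'' t := by
  classical
  set C : E →L[ℝ] E := G t₁ ∘L (G' t₁).inverse with hC
  have hCi : C.IsInvertible :=
    (hG t₁ ⟨ht₁, hd⟩).isInvertible.comp (hG' t₁ ⟨ht₁, hc, he⟩).isInvertible.inverse
  have hover : ∀ s ∈ S ∩ Ioo c (min d e), G s = C ∘L G' s := fun s hs ↦
    coframe_eq_comp (I := S ∩ Ioo c (min d e)) (hSc.inter (convex_Ioo _ _)) inter_subset_left
      (fun r hr ↦ inter_mem self_mem_nhdsWithin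
        (mem_nhdsWithin_of_mem_nhds (Ioo_mem_nhds hr.2.1 hr.2.2))) hS
      (fun r hr ↦ hG r ⟨hr.1, hr.2.2.trans_le (min_le_left _ _)⟩)
      (fun r hr ↦ hG' r ⟨hr.1, hr.2.1, hr.2.2.trans_le (min_le_right _ _)⟩)
      ⟨ht₁, hc, lt_min hd he⟩ hs
  refine ⟨fun t ↦ if t < t₁ then G t else C ∘L G' t, fun t ht ↦ ?_⟩
  rcases lt_or_ge t t₁ with htt | htt
  · refine (hG t ⟨ht.1, htt.trans hd⟩).congr ht.1
      (mem_nhdsWithin_of_mem_nhds (Filter.mem_of_superset (Iio_mem_nhds htt) fun s hs ↦ ?_))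
    exact if_pos hs
  · refine ((hG' t ⟨ht.1, hc.trans_le htt, ht.2⟩).clm_comp hCi).congr ht.1 ?_
    filter_upwards [self_mem_nhdsWithin,
      mem_nhdsWithin_of_mem_nhds (Ioi_mem_nhds (hc.trans_le htt))] with s hs hcs
    by_cases hst : s < t₁
    · rw [if_pos hst]
      exact hover s ⟨hs, hcs, hst.trans (lt_min hd he)⟩
    · rw [if_neg hst]

/-- Local parallel coframes along a curve on `[a, b]` can be glued to a global one. -/
theorem exists_coframe_of_local {a b : ℝ} (hab : a < b)
    (h : ∀ t₀ ∈ Icc a b, ∃ ε > 0, ∃ G : (t : ℝ) → TangentSpace 𝓘(ℝ, E) (X t) →L[ℝ] E,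
      ∀ t ∈ Icc a b ∩ Ioo (t₀ - ε) (t₀ + ε), IsParallelCoframeAt (Icc a b) X G t) :
    ∃ G : (t : ℝ) → TangentSpace 𝓘(ℝ, E) (X t) →L[ℝ] E,
      ∀ t ∈ Icc a b, IsParallelCoframeAt (Icc a b) X G t := by
  choose! ε hε G hG using h
  obtain ⟨t, ht0, htm, ⟨m, hm⟩, hcov⟩ := exists_monotone_Icc_subset_open_cover_Icc hab.le
    (c := fun i : Icc a b ↦ Subtype.val ⁻¹' Ioo ((i : ℝ) - ε i) (i + ε i))
    (fun i ↦ isOpen_Ioo.preimage continuous_subtype_val)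
    (fun i _ ↦ mem_iUnion.2 ⟨i, by
      have := hε i i.2
      exact ⟨by linarith, by linarith⟩⟩)
  -- Induction along the partition `t`: a coframe beyond `t n` is extended by the local coframe over
  -- an interval that contains `[t n, t (n + 1)]`.
  have key : ∀ n, ∃ d > (t n : ℝ), ∃ G : (t : ℝ) → TangentSpace 𝓘(ℝ, E) (X t) →L[ℝ] E,
      ∀ t ∈ Icc a b ∩ Iio d, IsParallelCoframeAt (Icc a b) X G t := by
    intro n
    induction n with
    | zero =>
      have ha : a ∈ Icc a b := left_mem_Icc.2 hab.le
      refine ⟨a + ε a, by rw [ht0]; linarith [hε a ha], G a, fun s hs ↦ hG a ha s ⟨hs.1, ?_, hs.2⟩⟩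
      linarith [hs.1.1, hε a ha]
    | succ n ih =>
      obtain ⟨d, hd, G₁, hG₁⟩ := ih
      obtain ⟨i, hi⟩ := hcov n
      have h₀ := hi (left_mem_Icc.2 (htm n.le_succ))
      have h₁ := hi (right_mem_Icc.2 (htm n.le_succ))
      obtain ⟨G₂, hG₂⟩ := exists_coframe_glue (convex_Icc a b) (uniqueDiffOn_Icc hab) (t n).2
        h₀.1 hd h₀.2 hG₁ (hG i i.2)
      exact ⟨_, h₁.2, G₂, hG₂⟩
  obtain ⟨d, hd, G, hG⟩ := key m
  rw [hm m le_rfl] at hd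
  exact ⟨G, fun s hs ↦ hG s ⟨hs, hs.2.trans_lt hd⟩⟩

end Coframe

/-! ### Existence of parallel coframes -/

section LocalCoframe

variable {E : Type*} [NormedAddCommGroup E] [NormedSpace ℝ E]
  {M : Type*} [TopologicalSpace M] [ChartedSpace E M] [IsManifold 𝓘(ℝ, E) ∞ M]

/-- A field along a `C^1` curve is `C^1` if and only if its coordinates in a chart are. -/
theorem isC1FieldAt_iff_chartCoord {S : Set ℝ} {X : ℝ → M}
    {A : (t : ℝ) → TangentSpace 𝓘(ℝ, E) (X t)} {t : ℝ} {x₀ : M} (htS : t ∈ S)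
    (hX : ContMDiffWithinAt 𝓘(ℝ, ℝ) 𝓘(ℝ, E) 1 X S t)
    (ht : X t ∈ (extChartAt 𝓘(ℝ, E) x₀).source) :
    IsC1FieldAt S X A t ↔ ContDiffWithinAt ℝ 1 (fun s ↦ chartCoord x₀ (A s)) S t := by
  set e := trivializationAt E (fun p : M ↦ TangentSpace 𝓘(ℝ, E) p) x₀ with he
  have hbase : ∀ p, p ∈ (extChartAt 𝓘(ℝ, E) x₀).source → p ∈ e.baseSet := fun p hp ↦ by
    rwa [he, TangentBundle.trivializationAt_baseSet, ← extChartAt_source 𝓘(ℝ, E)]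
  have hcoord : ∀ p, p ∈ (extChartAt 𝓘(ℝ, E) x₀).source → ∀ v : TangentSpace 𝓘(ℝ, E) p,
      (e ⟨p, v⟩).2 = chartCoord x₀ v := fun p hp v ↦ by
    rw [chartCoord, ← TangentBundle.continuousLinearMapAt_trivializationAt
      (by rwa [extChartAt_source] at hp)]
    exact (congrFun (e.coe_linearMapAt_of_mem (R := ℝ) (hbase p hp)) v).symm
  have hev : (fun s ↦ (e ⟨X s, A s⟩).2) =ᶠ[𝓝[S] t] fun s ↦ chartCoord x₀ (A s) :=
    (hX.continuousWithinAt.eventually ((isOpen_extChartAt_source x₀).mem_nhds ht)).mono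
      fun s hs ↦ hcoord _ hs _
  rw [IsC1FieldAt, Bundle.Trivialization.contMDiffWithinAt_iff (e := e)
    (e.mem_source.2 (hbase _ ht)), contMDiffWithinAt_iff_contDiffWithinAt]
  refine ⟨fun h ↦ h.2.congr_of_eventuallyEq_of_mem hev.symm htS,
    fun h ↦ ⟨hX, h.congr_of_eventuallyEq_of_mem hev htS⟩⟩

variable [FiniteDimensional ℝ E] [Bundle.RiemannianBundle (fun x : M ↦ TangentSpace 𝓘(ℝ, E) x)]
  [IsContMDiffRiemannianBundle 𝓘(ℝ, E) ∞ E (fun x : M ↦ TangentSpace 𝓘(ℝ, E) x)]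

/-- In a chart, a solution `V` of `V' = V Γ(x, x')` turns the coordinates of tangent vectors into a
parallel coframe. -/
theorem isParallelCoframeAt_of_ode {S : Set ℝ} {X : ℝ → M} {t : ℝ} {x₀ : M}
    (hS : UniqueDiffWithinAt ℝ S t) (htS : t ∈ S)
    (hX : ContMDiffWithinAt 𝓘(ℝ, ℝ) 𝓘(ℝ, E) 1 X S t)
    (ht : X t ∈ (extChartAt 𝓘(ℝ, E) x₀).source) {V : ℝ → E →L[ℝ] E}
    (hVi : ∀ᶠ s in 𝓝 t, (V s).IsInvertible) (hVc : ContDiffAt ℝ 1 V t)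
    (hV : HasDerivAt V (V t ∘L christoffelCLM x₀ (extChartAt 𝓘(ℝ, E) x₀ (X t))
      (derivWithin (fun s ↦ extChartAt 𝓘(ℝ, E) x₀ (X s)) S t)) t) :
    IsParallelCoframeAt S X
      (fun s ↦ V s ∘L mfderiv 𝓘(ℝ, E) 𝓘(ℝ, E) (extChartAt 𝓘(ℝ, E) x₀) (X s)) t := by
  have hx : ContDiffWithinAt ℝ 1 (fun s ↦ extChartAt 𝓘(ℝ, E) x₀ (X s)) S t := by
    rw [← contMDiffWithinAt_iff_contDiffWithinAt]
    exact (contMDiffAt_extChartAt' (by rwa [extChartAt_source] at ht)).comp_contMDiffWithinAt t hX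
  refine ⟨hVi.self_of_nhds.comp (isInvertible_mfderiv_extChartAt ht), fun A ↦ ?_, fun A hA ↦ ?_⟩
  · rw [isC1FieldAt_iff_chartCoord htS hX ht]
    refine ⟨fun h ↦ hVc.contDiffWithinAt.clm_apply h, fun h ↦ ?_⟩
    have hinv : ContDiffAt ℝ 1 (fun s ↦ (V s).inverse) t :=
      hVi.self_of_nhds.contDiffAt_map_inverse.comp t hVc
    refine (hinv.contDiffWithinAt.clm_apply h).congr_of_eventuallyEq_of_mem ?_ htS
    filter_upwards [mem_nhdsWithin_of_mem_nhds hVi] with s hs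
    exact (hs.inverse_apply_self _).symm
  · have hα : DifferentiableWithinAt ℝ (fun s ↦ chartCoord x₀ (A s)) S t :=
      ((isC1FieldAt_iff_chartCoord htS hX ht).1 hA).differentiableWithinAt (by simp)
    have hcov := chartCoord_covDerivAlong hS htS hX.continuousWithinAt ht
      (hx.differentiableWithinAt (by simp)) hα
    have h := hV.hasDerivWithinAt.clm_apply hα.hasDerivWithinAt
    refine HasDerivWithinAt.congr_deriv h ?_
    change _ = V t (chartCoord x₀ (covDerivAlong S X A t))
    rw [hcov, map_add, add_comm]
    rfl

/-- Near each time there is a parallel coframe, given by a solution of the parallel transport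
equation in a chart. -/
theorem exists_local_coframe {a b : ℝ} (hab : a < b) {X : ℝ → M}
    (hX : ContMDiffOn 𝓘(ℝ, ℝ) 𝓘(ℝ, E) ∞ X (Icc a b)) {t₀ : ℝ} (ht₀ : t₀ ∈ Icc a b) :
    ∃ ε > 0, ∃ G : (t : ℝ) → TangentSpace 𝓘(ℝ, E) (X t) →L[ℝ] E,
      ∀ t ∈ Icc a b ∩ Ioo (t₀ - ε) (t₀ + ε), IsParallelCoframeAt (Icc a b) X G t := by
  have hS := uniqueDiffOn_Icc hab
  set x₀ := X t₀ with hx₀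
  set x : ℝ → E := fun s ↦ extChartAt 𝓘(ℝ, E) x₀ (X s) with hx
  have hsrc : ∀ᶠ s in 𝓝[Icc a b] t₀, X s ∈ (extChartAt 𝓘(ℝ, E) x₀).source :=
    (hX t₀ ht₀).continuousWithinAt.eventually
      ((isOpen_extChartAt_source x₀).mem_nhds (mem_extChartAt_source x₀))
  obtain ⟨δ, hδ, hδs⟩ := Metric.eventually_nhds_iff_ball.1 (eventually_nhdsWithin_iff.1 hsrc)
  rw [Real.ball_eq_Ioo] at hδs
  set S' := Icc a b ∩ Ioo (t₀ - δ) (t₀ + δ) with hS'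
  have hS'd : UniqueDiffOn ℝ S' := hS.inter isOpen_Ioo
  have hxd : ContDiffOn ℝ 1 x S' := by
    rw [← contMDiffOn_iff_contDiffOn]
    intro s hs
    have hss := hδs s hs.2 hs.1
    rw [extChartAt_source] at hss
    exact ((contMDiffAt_extChartAt' hss).comp_contMDiffWithinAt s
      ((hX s hs.1).of_le (by simp))).mono inter_subset_left
  have hu : ContinuousOn (derivWithin x (Icc a b)) S' :=
    (hxd.continuousOn_derivWithin hS'd le_rfl).congr fun s hs ↦
      (derivWithin_inter (Ioo_mem_nhds hs.2.1 hs.2.2)).symm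
  have hB := continuousOn_christoffelCLM x₀ hxd.continuousOn hu fun s hs ↦
    (extChartAt 𝓘(ℝ, E) x₀).map_source (hδs s hs.2 hs.1)
  set B : ℝ → E →L[ℝ] E := fun s ↦ christoffelCLM x₀ (x s) (derivWithin x (Icc a b) s) with hBdef
  -- The coefficient is extended from a compact neighbourhood of `t₀` to a continuous function on
  -- the whole line, by constants.
  have hcd : max a (t₀ - δ / 2) ≤ min b (t₀ + δ / 2) :=
    max_le (le_min hab.le (by linarith [ht₀.1])) (le_min (by linarith [ht₀.2]) (by linarith))
  set pr : ℝ → ℝ := fun s ↦ projIcc _ _ hcd s with hpr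
  have hpr_mem : ∀ s, pr s ∈ S' := fun s ↦ by
    have h := (projIcc _ _ hcd s).2
    rw [mem_Icc, max_le_iff, le_min_iff] at h
    exact ⟨⟨h.1.1, h.2.1⟩, by linarith [h.1.2], by linarith [h.2.2]⟩
  have hpr_eq : ∀ s ∈ Icc a b ∩ Ioo (t₀ - δ / 2) (t₀ + δ / 2), pr s = s := fun s hs ↦ by
    simp only [hpr, projIcc_of_mem hcd
      (show s ∈ Icc _ _ from ⟨max_le hs.1.1 hs.2.1.le, le_min hs.1.2 hs.2.2.le⟩)]
  have hBc : Continuous fun s ↦ B (pr s) :=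
    hB.comp_continuous (continuous_subtype_val.comp continuous_projIcc) hpr_mem
  obtain ⟨ε, hε, V, hV₀, hVc, hV⟩ := exists_hasDerivAt_linear_ode
    (A := fun s ↦ (ContinuousLinearMap.compL ℝ E E E).flip (B (pr s)))
    ((ContinuousLinearMap.continuous _).comp hBc) t₀ (ContinuousLinearMap.id ℝ E)
  have hVi : ∀ᶠ s in 𝓝 t₀, (V s).IsInvertible := by
    have hcont : ContinuousAt V t₀ := (hV t₀ ⟨by linarith, by linarith⟩).continuousAt
    refine hcont.eventually ?_
    rw [hV₀]
    exact ContinuousLinearEquiv.nhds (ContinuousLinearEquiv.refl ℝ E)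
  obtain ⟨η, hη, hηV⟩ := Metric.eventually_nhds_iff_ball.1 hVi
  rw [Real.ball_eq_Ioo] at hηV
  refine ⟨min (min ε η) (δ / 2), by positivity,
    fun s ↦ V s ∘L mfderiv 𝓘(ℝ, E) 𝓘(ℝ, E) (extChartAt 𝓘(ℝ, E) x₀) (X s), fun t ht ↦ ?_⟩
  have h₁ : min (min ε η) (δ / 2) ≤ ε := (min_le_left _ _).trans (min_le_left _ _)
  have h₂ : min (min ε η) (δ / 2) ≤ η := (min_le_left _ _).trans (min_le_right _ _)
  have h₃ : min (min ε η) (δ / 2) ≤ δ / 2 := min_le_right _ _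
  have htε : t ∈ Ioo (t₀ - ε) (t₀ + ε) := ⟨by linarith [ht.2.1], by linarith [ht.2.2]⟩
  have htη : t ∈ Ioo (t₀ - η) (t₀ + η) := ⟨by linarith [ht.2.1], by linarith [ht.2.2]⟩
  have htδ : t ∈ Ioo (t₀ - δ / 2) (t₀ + δ / 2) := ⟨by linarith [ht.2.1], by linarith [ht.2.2]⟩
  refine isParallelCoframeAt_of_ode (hS t ht.1) ht.1 ((hX t ht.1).of_le (by simp))
    (hδs t ⟨by linarith [htδ.1], by linarith [htδ.2]⟩ ht.1)
    (Filter.mem_of_superset (Ioo_mem_nhds htη.1 htη.2) hηV)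
    (hVc.contDiffAt (Ioo_mem_nhds htε.1 htε.2)) ?_
  have h := hV t htε
  rw [hpr_eq t ⟨ht.1, htδ⟩] at h
  exact h

/-- Every smooth curve on `[a, b]` carries a parallel coframe. -/
theorem exists_coframe {a b : ℝ} (hab : a < b) {X : ℝ → M}
    (hX : ContMDiffOn 𝓘(ℝ, ℝ) 𝓘(ℝ, E) ∞ X (Icc a b)) :
    ∃ G : (t : ℝ) → TangentSpace 𝓘(ℝ, E) (X t) →L[ℝ] E,
      ∀ t ∈ Icc a b, IsParallelCoframeAt (Icc a b) X G t :=
  exists_coframe_of_local hab fun _ ht₀ ↦ exists_local_coframe hab hX ht₀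

end LocalCoframe

/-! ### Parallel transport and the fundamental theorem of calculus -/

section Transport

variable {E : Type*} [NormedAddCommGroup E] [NormedSpace ℝ E]
  {M : Type*} [TopologicalSpace M] [ChartedSpace E M] [IsManifold 𝓘(ℝ, E) ∞ M]
  [Bundle.RiemannianBundle (fun x : M ↦ TangentSpace 𝓘(ℝ, E) x)]

/-- In a parallel coframe, parallel transport does not change the coordinates of a vector. -/
theorem parallelTransport_eq_of_coframe {S : Set ℝ} {X : ℝ → M}
    {G : (t : ℝ) → TangentSpace 𝓘(ℝ, E) (X t) →L[ℝ] E} (hSc : Convex ℝ S) (hS : UniqueDiffOn ℝ S)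
    (hG : ∀ t ∈ S, IsParallelCoframeAt S X G t) {s t : ℝ} (hs : s ∈ S) (ht : t ∈ S)
    (v : TangentSpace 𝓘(ℝ, E) (X s)) :
    parallelTransport S X s t v = (G t).inverse (G s v) := by
  have hex : ∃ P : (r : ℝ) → TangentSpace 𝓘(ℝ, E) (X r), IsParallelAlong S X P ∧ P s = v := by
    have hp : ∀ r ∈ S, IsC1FieldAt S X (fun q ↦ (G q).inverse (G s v)) r ∧
        covDerivAlong S X (fun q ↦ (G q).inverse (G s v)) r = 0 := fun r hr ↦
      (hG r hr).parallel_of_eventually_const hr (hS r hr) (c := G s v)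
        (Filter.mem_of_superset self_mem_nhdsWithin fun q hq ↦
          (hG q hq).isInvertible.self_apply_inverse (G s v))
    exact ⟨fun q ↦ (G q).inverse (G s v), ⟨fun r hr ↦ (hp r hr).1, fun r hr ↦ (hp r hr).2⟩,
      (hG s hs).isInvertible.inverse_apply_self v⟩
  rw [parallelTransport, dif_pos hex]
  have hspec := hex.choose_spec
  have h := coframe_apply_parallel_eq hSc subset_rfl hG (A := hex.choose)
    (fun r hr ↦ hspec.1.1 r hr) hspec.1.2 ht hs
  rw [hspec.2] at h
  rw [← h]
  exact ((hG t ht).isInvertible.inverse_apply_self _).symm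

/-- On a one-point set `derivWithin` is zero, and hence so is the covariant derivative. -/
theorem covDerivAlong_of_subsingleton [FiniteDimensional ℝ E]
    [IsContMDiffRiemannianBundle 𝓘(ℝ, E) ∞ E (fun x : M ↦ TangentSpace 𝓘(ℝ, E) x)]
    {S : Set ℝ} (hS : S.Subsingleton) (X : ℝ → M)
    (A : (t : ℝ) → TangentSpace 𝓘(ℝ, E) (X t)) (t : ℝ) : covDerivAlong S X A t = 0 := by
  have h : ∀ f : ℝ → E, derivWithin f S t = 0 := fun f ↦ by
    rw [derivWithin, fderivWithin, if_pos (HasFDerivWithinAt.of_subsingleton hS)]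
    rfl
  simp only [covDerivAlong, h, christoffel_zero_left, add_zero]
  exact map_zero _

theorem parallelTransport_self_of_subsingleton [FiniteDimensional ℝ E]
    [IsContMDiffRiemannianBundle 𝓘(ℝ, E) ∞ E (fun x : M ↦ TangentSpace 𝓘(ℝ, E) x)]
    {S : Set ℝ} (hS : S.Subsingleton) {X : ℝ → M} {A : (t : ℝ) → TangentSpace 𝓘(ℝ, E) (X t)}
    (hA : IsFieldAlong 1 S X A) (t : ℝ) : parallelTransport S X t t (A t) = A t := by
  have hex : ∃ P : (r : ℝ) → TangentSpace 𝓘(ℝ, E) (X r), IsParallelAlong S X P ∧ P t = A t :=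
    ⟨A, ⟨hA, fun r _ ↦ covDerivAlong_of_subsingleton hS X A r⟩, rfl⟩
  rw [parallelTransport, dif_pos hex]
  exact hex.choose_spec.2

theorem integral_parallelTransport_covDerivAlong [FiniteDimensional ℝ E]
    [IsContMDiffRiemannianBundle 𝓘(ℝ, E) ∞ E (fun x : M ↦ TangentSpace 𝓘(ℝ, E) x)]
    {a b : ℝ} (hab : a < b) {X : ℝ → M} (hX : ContMDiffOn 𝓘(ℝ, ℝ) 𝓘(ℝ, E) ∞ X (Icc a b))
    {A : (t : ℝ) → TangentSpace 𝓘(ℝ, E) (X t)} (hA : IsFieldAlong 1 (Icc a b) X A) :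
    IntervalIntegrable
        (fun t ↦ parallelTransport (Icc a b) X t a (covDerivAlong (Icc a b) X A t))
        MeasureTheory.volume a b ∧
      parallelTransport (Icc a b) X b a (A b) - A a =
        ∫ t in a..b, parallelTransport (Icc a b) X t a (covDerivAlong (Icc a b) X A t) := by
  obtain ⟨G, hG⟩ := exists_coframe hab hX
  have hS := uniqueDiffOn_Icc hab
  have ha : a ∈ Icc a b := left_mem_Icc.2 hab.le
  have hPT : ∀ t ∈ Icc a b, ∀ v : TangentSpace 𝓘(ℝ, E) (X t),
      parallelTransport (Icc a b) X t a v = (G a).inverse (G t v) := fun t ht v ↦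
    parallelTransport_eq_of_coframe (convex_Icc a b) hS hG ht ha v
  have hg : ContDiffOn ℝ 1 (fun s ↦ G s (A s)) (Icc a b) := fun t ht ↦
    ((hG t ht).isC1FieldAt_iff A).1 (hA t ht)
  have hgd : ∀ t ∈ Icc a b,
      HasDerivWithinAt (fun s ↦ G s (A s)) (G t (covDerivAlong (Icc a b) X A t)) (Icc a b) t :=
    fun t ht ↦ (hG t ht).hasDerivWithinAt A (hA t ht)
  have hgc : ContinuousOn (fun t ↦ G t (covDerivAlong (Icc a b) X A t)) (Icc a b) :=
    (hg.continuousOn_derivWithin hS le_rfl).congr fun t ht ↦ ((hgd t ht).derivWithin (hS t ht)).symm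
  have hfc : ContinuousOn (fun t ↦ parallelTransport (Icc a b) X t a
      (covDerivAlong (Icc a b) X A t)) (Icc a b) :=
    ((G a).inverse.continuous.comp_continuousOn hgc).congr fun t ht ↦ hPT t ht _
  have hint : IntervalIntegrable (fun t ↦ G t (covDerivAlong (Icc a b) X A t))
      MeasureTheory.volume a b := hgc.intervalIntegrable_of_Icc hab.le
  refine ⟨hfc.intervalIntegrable_of_Icc hab.le, ?_⟩
  have hFTC := intervalIntegral.integral_eq_sub_of_hasDerivAt_of_le hab.le hg.continuousOn
    (fun t ht ↦ (hgd t (Ioo_subset_Icc_self ht)).hasDerivAt (Icc_mem_nhds ht.1 ht.2)) hint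
  have hcongr : (∫ t in a..b, parallelTransport (Icc a b) X t a (covDerivAlong (Icc a b) X A t)) =
      ∫ t in a..b, (G a).inverse (G t (covDerivAlong (Icc a b) X A t)) :=
    intervalIntegral.integral_congr fun t ht ↦ hPT t (by rwa [uIcc_of_le hab.le] at ht) _
  -- Completeness is for the Riemannian norm, which is not the norm of `E`.
  have : FiniteDimensional ℝ (TangentSpace 𝓘(ℝ, E) (X a)) := inferInstanceAs (FiniteDimensional ℝ E)
  have : CompleteSpace (TangentSpace 𝓘(ℝ, E) (X a)) := FiniteDimensional.complete ℝ _
  rw [hcongr, (G a).inverse.intervalIntegral_comp_comm hint, hFTC, map_sub,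
    (hG a ha).isInvertible.inverse_apply_self, hPT b (right_mem_Icc.2 hab.le)]

end Transport

end RiemannianCurve

theorem mainTheorem10
    {E : Type*} [NormedAddCommGroup E] [NormedSpace ℝ E] [FiniteDimensional ℝ E]
    {M : Type*} [TopologicalSpace M] [ChartedSpace E M] [IsManifold 𝓘(ℝ, E) ∞ M]
    [Bundle.RiemannianBundle (fun x : M ↦ TangentSpace 𝓘(ℝ, E) x)]
    [IsContMDiffRiemannianBundle 𝓘(ℝ, E) ∞ E (fun x : M ↦ TangentSpace 𝓘(ℝ, E) x)]
    {a b : ℝ} (hab : a ≤ b)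
    (X : ℝ → M) (hX : ContMDiffOn 𝓘(ℝ, ℝ) 𝓘(ℝ, E) ∞ X (Set.Icc a b))
    (A : (t : ℝ) → TangentSpace 𝓘(ℝ, E) (X t))
    (hA : RiemannianCurve.IsFieldAlong 1 (Set.Icc a b) X A) :
    IntervalIntegrable
        (fun t ↦ RiemannianCurve.parallelTransport (Set.Icc a b) X t a
          (RiemannianCurve.covDerivAlong (Set.Icc a b) X A t))
        MeasureTheory.volume a b ∧
      RiemannianCurve.parallelTransport (Set.Icc a b) X b a (A b) - A a =
        ∫ t in a..b, RiemannianCurve.parallelTransport (Set.Icc a b) X t a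
          (RiemannianCurve.covDerivAlong (Set.Icc a b) X A t) := by
  rcases hab.eq_or_lt with rfl | hlt
  -- On a one-point interval every field is parallel, since `derivWithin` vanishes there.
  · refine ⟨IntervalIntegrable.refl, ?_⟩
    rw [intervalIntegral.integral_same,
      RiemannianCurve.parallelTransport_self_of_subsingleton (by simp) hA, sub_self]
  · exact RiemannianCurve.integral_parallelTransport_covDerivAlong hlt hX hA
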